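/- For $a,p\in[0,1]$ let $h_a(p)=\bigl(\sqrt{p(1-a)}-\sqrt{a(1-p)}\bigr)^2$. Let $n\ge 0$ and $0<a_1<\dots<a_n<1$, let $D=(0,a_1)\cup(a_1,a_2)\cup\dots\cup(a_n,1)=(0,1)\setminus\{a_1,\dots,a_n\}$, and let $f:D\to[0,1]$ be continuous. Suppose that there are a finite list $a_1,\dots,a_{n'}$ ($n'\ge n$) of points of $[0,1]$ containing $a_1,\dots,a_n$ and an integer $k\ge 0$ such that, with $$a(p)=p(1-p)\prod_{1\le i\le n'}h_{a_i}(p)\bigl(1-h_{a_i}(p)\bigr),$$ $$a(p)^k\le f(p)\le 1-a(p)^k\qquad\text{for all }p\in D.$$ Then $f$ is constructible with quoins and a finite set of single-qubit unitaries. Explicitly, let $|p\rangle=\sqrt p\,|0\rangle+\sqrt{1-p}\,|1\rangle$ (a quoin) and $H(b)=\begin{pmatrix}\sqrt{1-b}&\sqrt b\\ \sqrt b&-\sqrt{1-b}\end{pmatrix}$ for $b\in[0,1]$. There are finitely many unitaries $U_1=H(b_1),\dots,U_m=H(b_m)$ and a measurable set $S$ of $m$-tuples of infinite $\{0,1\}$-sequences,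 all independent of $p$, such that for every $p\in D$ the following holds. Let $P_p$ be the law of $m$ independent sequences of independent outcomes, the $i$-th sequence being obtained by measuring copies of $U_i|p\rangle$ in the computational basis, so that outcome $v\in\{0,1\}$ has probability $|\langle v|U_i|p\rangle|^2$. Then $P_p$-almost surely finitely many of the outcomes determine whether the tuple of sequences lies in $S$, and $P_p(S)=f(p)$. -/

import Mathlib

open MeasureTheory
open scoped Matrix

noncomputable section

namespace QuoinFactory

/-- The state `|p⟩ = √p |0⟩ + √(1-p) |1⟩` of a quoin of bias `p ∈ [0,1]`. -/
def quoin (p : unitInterval) : Fin 2 → ℂ :=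
  ![((Real.sqrt (p : ℝ) : ℝ) : ℂ), ((Real.sqrt (1 - (p : ℝ)) : ℝ) : ℂ)]

/-- `|⟨v|U|p⟩|²`: the probability that measuring `U |p⟩` in the computational basis yields `v`. -/
def outcomeProb (U : Matrix.unitaryGroup (Fin 2) ℂ) (p : unitInterval) (v : Fin 2) : ℝ :=
  ‖((U : Matrix (Fin 2) (Fin 2) ℂ) *ᵥ quoin p) v‖ ^ 2

theorem sum_outcomeProb (U : Matrix.unitaryGroup (Fin 2) ℂ) (p : unitInterval) :
    ∑ v, outcomeProb U p v = 1 := by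
  have key : ∀ w : Fin 2 → ℂ, ((∑ v, ‖w v‖ ^ 2 : ℝ) : ℂ) = star w ⬝ᵥ w := by
    intro w
    simp [dotProduct, Complex.conj_mul']
  have hU : (star (U : Matrix (Fin 2) (Fin 2) ℂ)) * (U : Matrix (Fin 2) (Fin 2) ℂ) = 1 :=
    Matrix.mem_unitaryGroup_iff'.mp U.2
  have h1 : ((∑ v, outcomeProb U p v : ℝ) : ℂ) = ((∑ v, ‖quoin p v‖ ^ 2 : ℝ) : ℂ) := by
    unfold outcomeProb
    rw [key, key, Matrix.star_mulVec, ← Matrix.dotProduct_mulVec, Matrix.mulVec_mulVec,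
      ← Matrix.star_eq_conjTranspose, hU, Matrix.one_mulVec]
  rw [Complex.ofReal_inj.mp h1, Fin.sum_univ_two]
  have h0 := p.2.1
  have h2 : (0 : ℝ) ≤ 1 - (p : ℝ) := sub_nonneg.mpr p.2.2
  simp [quoin, Real.sq_sqrt h0, Real.sq_sqrt h2]

/-- The coin obtained by applying `U` to a quoin and measuring in the computational basis. -/
def coin (U : Matrix.unitaryGroup (Fin 2) ℂ) (p : unitInterval) : PMF (Fin 2) :=
  PMF.ofFintype (fun v => ENNReal.ofReal (outcomeProb U p v)) (by
    rw [← ENNReal.ofReal_sum_of_nonneg (fun v _ => by unfold outcomeProb; positivity),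
      sum_outcomeProb, ENNReal.ofReal_one])

/-- The sample space: for each of `m` unitaries an infinite sequence of outcomes in `{0,1}`;
`ω (i, j)` is the outcome of the `j`-th quoin that is measured after the `i`-th unitary. -/
abbrev Flips (m : ℕ) : Type := Fin m × ℕ → Fin 2

/-- The law `P_{p,G}`: all the outcomes are independent, and those of the `i`-th sequence are
distributed as `coin (G i) p`. -/
def flipLaw {m : ℕ} (G : Fin m → Matrix.unitaryGroup (Fin 2) ℂ) (p : unitInterval) :
    Measure (Flips m) :=
  Measure.infinitePi (fun ij : Fin m × ℕ => (coin (G ij.1) p).toMeasure)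

/-- Finitely many outcomes of `ω`, namely the first `N` of each of the `m` sequences for some `N`,
determine whether the event `S` occurs. -/
def DecidedAt {m : ℕ} (S : Set (Flips m)) (ω : Flips m) : Prop :=
  ∃ N : ℕ, ∀ ω' : Flips m, (∀ i : Fin m, ∀ j < N, ω' (i, j) = ω (i, j)) → (ω' ∈ S ↔ ω ∈ S)

/-- `S` is discernible with respect to `μ`: the probability that infinitely many flips are needed
to decide whether `S` occurs is zero. -/
def Discernible {m : ℕ} (μ : Measure (Flips m)) (S : Set (Flips m)) : Prop :=
  ∀ᵐ ω ∂μ, DecidedAt S ω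

theorem hadamardMatrix_mem (a : unitInterval) :
    !![((Real.sqrt (1 - (a : ℝ)) : ℝ) : ℂ), ((Real.sqrt (a : ℝ) : ℝ) : ℂ);
       ((Real.sqrt (a : ℝ) : ℝ) : ℂ), -((Real.sqrt (1 - (a : ℝ)) : ℝ) : ℂ)]
      ∈ Matrix.unitaryGroup (Fin 2) ℂ := by
  have h0 : (0 : ℝ) ≤ a := a.2.1
  have h1 : (0 : ℝ) ≤ 1 - (a : ℝ) := sub_nonneg.mpr a.2.2
  have e0 : ((Real.sqrt (a : ℝ) : ℝ) : ℂ) * ((Real.sqrt (a : ℝ) : ℝ) : ℂ) = ((a : ℝ) : ℂ) := by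
    rw [← Complex.ofReal_mul, Real.mul_self_sqrt h0]
  have e1 : ((Real.sqrt (1 - (a : ℝ)) : ℝ) : ℂ) * ((Real.sqrt (1 - (a : ℝ)) : ℝ) : ℂ)
      = 1 - ((a : ℝ) : ℂ) := by
    rw [← Complex.ofReal_mul, Real.mul_self_sqrt h1]; push_cast; ring
  rw [Matrix.mem_unitaryGroup_iff, Matrix.star_eq_conjTranspose]
  ext i j
  fin_cases i <;> fin_cases j <;>
    simp [Matrix.mul_apply, Fin.sum_univ_two, Matrix.conjTranspose_apply, Complex.conj_ofReal,
      e0, e1] <;> ring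

/-- The single-qubit unitary `H(a)` with rows `(√(1-a), √a)` and `(√a, -√(1-a))`, `a ∈ [0,1]`. -/
def hadamard (a : unitInterval) : Matrix.unitaryGroup (Fin 2) ℂ :=
  ⟨!![((Real.sqrt (1 - (a : ℝ)) : ℝ) : ℂ), ((Real.sqrt (a : ℝ) : ℝ) : ℂ);
      ((Real.sqrt (a : ℝ) : ℝ) : ℂ), -((Real.sqrt (1 - (a : ℝ)) : ℝ) : ℂ)], hadamardMatrix_mem a⟩

/-- `f` is constructible on `D ⊆ [0,1]` with quoins and a finite set of single-qubit unitaries, all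
of them of the form `H(b)`: some event, fixed independently of the unknown bias `p`, is discernible
and has probability `f p`, for every `p ∈ D`. -/
def ConstructibleOn (D : Set ℝ) (f : ℝ → ℝ) : Prop :=
  ∃ (m : ℕ) (b : Fin m → unitInterval) (S : Set (Flips m)), MeasurableSet S ∧
    ∀ p : unitInterval, (p : ℝ) ∈ D →
      Discernible (flipLaw (fun i => hadamard (b i)) p) S ∧
      flipLaw (fun i => hadamard (b i)) p S = ENNReal.ofReal (f p)

/-- `h_a(p) = (√(p(1-a)) - √(a(1-p)))²`. -/
def hFun (a p : ℝ) : ℝ := (Real.sqrt (p * (1 - a)) - Real.sqrt (a * (1 - p))) ^ 2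

/-- `a(p) = p (1-p) ∏ h_{a_i}(p) (1 - h_{a_i}(p))`, the product over the list `L` of the `a_i`. -/
def aFun (L : List ℝ) (p : ℝ) : ℝ :=
  p * (1 - p) * (L.map (fun c => hFun c p * (1 - hFun c p))).prod

end QuoinFactory

end

/-!
The coin `H(0)|p⟩` shows `0` with probability `p`, and `H(1-c)|p⟩` shows `1` with probability
`h_c(p)`. Probabilities of events that depend on finitely many of these flips (`Realizable`) are
closed under products and complements, and they contain rounded Bernstein polynomials in `p`, which
approximate continuous functions uniformly on compact subsets of `(0,1)`.

The factory follows Keane and O'Brien. Let `φ` be the target and write `a` for `aFun L`. Choose a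
realizable `y ≤ φ / 2`, answer "yes" with probability `y`, and otherwise go on with the
complementary target `φ' = (1 - φ) / (1 - y)`, so that `φ = y + (1 - y) (1 - φ')`. As `1 - φ ≤ φ'`
and `φ / 2 ≤ 1 - φ'`, lower bounds of the form `κ a ^ k` on the target and on its complement
survive, with `κ / 2` in place of `κ`. Two consecutive targets have sum at least `1`, so one of them
is at least `1/2`. If `y ≥ 1/32` whenever the target is at least `1/2` on a compact set that grows
with the step and exhausts `D`, then at each `p ∈ D` the probability of being undecided tends to
zero (`tendsto_prod_one_sub`), and the first decision yields the required event
(`exists_event_of_steps`).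

One such `y` is constructed in `exists_step`. A point `c` of `L` may lie in `D`, and then `a`
vanishes there while `φ` need not be small. Such points are dropped when `φ c ≥ 1/4`
(`exists_mul_badPoints_le`): for the remaining list `Z` still `κ' (aProd Z) ^ k ≤ φ`, and now
`aProd Z` is positive wherever `φ ≥ 1/2`. Then `y = w g`, where
`w = 1 - (1 - (aProd Z) ^ (k+1)) ^ M ≤ M (aProd Z) ^ (k+1)` is at most `φ / 2` off a compact set
`{η ≤ aProd Z} ⊆ D`, and `g` is a Bernstein polynomial with `φ / 8 ≤ g ≤ φ / 2` on that set.
-/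

open ProbabilityTheory

noncomputable section

namespace QuoinFactory

/-! ### Events determined by a block of rounds -/

instance isProbabilityMeasure_flipLaw {m : ℕ} (G : Fin m → Matrix.unitaryGroup (Fin 2) ℂ)
    (p : unitInterval) : IsProbabilityMeasure (flipLaw G p) := by
  unfold flipLaw; infer_instance

/-- Whether `E` occurs is determined by the rounds `a ≤ j < b`, where round `j` consists of the
`j`-th outcome of each of the `m` sequences. -/
def DeterminedBy {m : ℕ} (E : Set (Flips m)) (a b : ℕ) : Prop :=
  ∀ ω ω' : Flips m, (∀ i j, a ≤ j → j < b → ω (i, j) = ω' (i, j)) → (ω ∈ E ↔ ω' ∈ E)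

section DeterminedBy

variable {m : ℕ} {E F : Set (Flips m)} {a b : ℕ}

theorem DeterminedBy.mono (h : DeterminedBy E a b) {a' b' : ℕ} (ha : a' ≤ a) (hb : b ≤ b') :
    DeterminedBy E a' b' :=
  fun ω ω' hω => h ω ω' fun i j h1 h2 => hω i j (ha.trans h1) (h2.trans_le hb)

theorem DeterminedBy.compl (h : DeterminedBy E a b) : DeterminedBy Eᶜ a b :=
  fun ω ω' hω => not_congr (h ω ω' hω)

theorem DeterminedBy.inter (h : DeterminedBy E a b) (h' : DeterminedBy F a b) :
    DeterminedBy (E ∩ F) a b :=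
  fun ω ω' hω => and_congr (h ω ω' hω) (h' ω ω' hω)

/-- An event determined by a block is a preimage under the projection to the finitely many outcomes
of that block. -/
theorem DeterminedBy.preimage_image (h : DeterminedBy E a b) :
    (fun (ω : Flips m) (i : (Finset.univ ×ˢ Finset.Ico a b : Finset (Fin m × ℕ))) => ω i) ⁻¹'
      ((fun (ω : Flips m) (i : (Finset.univ ×ˢ Finset.Ico a b : Finset (Fin m × ℕ))) => ω i) '' E)
      = E := by
  refine Set.Subset.antisymm ?_ (Set.subset_preimage_image _ _)
  rintro ω ⟨ω', hω', he⟩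
  refine (h ω' ω fun i j h1 h2 => ?_).1 hω'
  exact congrFun he ⟨(i, j), by simp [h1, h2]⟩

theorem DeterminedBy.measurableSet (h : DeterminedBy E a b) : MeasurableSet E := by
  rw [← h.preimage_image]
  exact measurableSet_preimage (by fun_prop) (Set.toFinite _).measurableSet

/-- Events determined by disjoint blocks of rounds are independent. -/
theorem DeterminedBy.real_inter {c : ℕ} (G : Fin m → Matrix.unitaryGroup (Fin 2) ℂ)
    (p : unitInterval) (hE : DeterminedBy E a b) (hF : DeterminedBy F b c) :
    (flipLaw G p).real (E ∩ F) = (flipLaw G p).real E * (flipLaw G p).real F := by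
  have hind : iIndepFun (fun (i : Fin m × ℕ) (ω : Flips m) => ω i) (flipLaw G p) :=
    iIndepFun_infinitePi (X := fun _ x => x) (fun _ => measurable_id)
  have hd : Disjoint (Finset.univ ×ˢ Finset.Ico a b : Finset (Fin m × ℕ))
      (Finset.univ ×ˢ Finset.Ico b c) :=
    Finset.disjoint_product.2 (Or.inr (Finset.Ico_disjoint_Ico_consecutive a b c))
  have h := (hind.indepFun_finset _ _ hd (by fun_prop)).measure_inter_preimage_eq_mul
    ((fun (ω : Flips m) i => ω i) '' E) ((fun (ω : Flips m) i => ω i) '' F)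
    (Set.toFinite _).measurableSet (Set.toFinite _).measurableSet
  rw [hE.preimage_image, hF.preimage_image] at h
  simp [Measure.real, h]

end DeterminedBy

/-! ### Probabilities realizable with finitely many flips -/

/-- `u` is the probability, as a function of the bias, of an event determined by finitely many
rounds. The block of rounds can be placed after any given round `a`, so that fresh outcomes are
available for each new event. -/
def Realizable {m : ℕ} (G : Fin m → Matrix.unitaryGroup (Fin 2) ℂ) (u : unitInterval → ℝ) : Prop :=
  ∀ a : ℕ, ∃ b, a ≤ b ∧ ∃ E : Set (Flips m), DeterminedBy E a b ∧
    ∀ p, (flipLaw G p).real E = u p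

section Realizable

variable {m : ℕ} {G : Fin m → Matrix.unitaryGroup (Fin 2) ℂ} {u v : unitInterval → ℝ}

theorem Realizable.nonneg (hu : Realizable G u) (p : unitInterval) : 0 ≤ u p := by
  obtain ⟨b, -, E, -, h⟩ := hu 0
  exact h p ▸ measureReal_nonneg

theorem Realizable.le_one (hu : Realizable G u) (p : unitInterval) : u p ≤ 1 := by
  obtain ⟨b, -, E, -, h⟩ := hu 0
  exact h p ▸ measureReal_le_one

theorem Realizable.one : Realizable G (fun _ => 1) :=
  fun a => ⟨a, le_rfl, Set.univ, fun _ _ _ => Iff.rfl, fun _ => by simp⟩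

theorem Realizable.compl (hu : Realizable G u) : Realizable G (fun p => 1 - u p) := by
  intro a
  obtain ⟨b, hab, E, hE, h⟩ := hu a
  refine ⟨b, hab, Eᶜ, hE.compl, fun p => ?_⟩
  rw [probReal_compl_eq_one_sub hE.measurableSet, h]

theorem Realizable.mul (hu : Realizable G u) (hv : Realizable G v) :
    Realizable G (fun p => u p * v p) := by
  intro a
  obtain ⟨b, hab, E, hE, hu⟩ := hu a
  obtain ⟨c, hbc, F, hF, hv⟩ := hv b
  refine ⟨c, hab.trans hbc, E ∩ F, (hE.mono le_rfl hbc).inter (hF.mono hab le_rfl), fun p => ?_⟩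
  rw [hE.real_inter G p hF, hu, hv]

theorem Realizable.pow (hu : Realizable G u) (n : ℕ) : Realizable G (fun p => u p ^ n) := by
  induction n with
  | zero => simpa using Realizable.one
  | succ n ih => simpa only [pow_succ] using ih.mul hu

theorem Realizable.list_prod {ι : Type*} (l : List ι) (w : ι → unitInterval → ℝ)
    (h : ∀ i ∈ l, Realizable G (w i)) : Realizable G (fun p => (l.map fun i => w i p).prod) := by
  induction l with
  | nil => simpa using Realizable.one
  | cons i l ih =>
    simpa using (h i (by simp)).mul (ih fun j hj => h j (by simp [hj]))

theorem coin_toMeasure_real (U : Matrix.unitaryGroup (Fin 2) ℂ) (p : unitInterval) (v : Fin 2) :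
    (coin U p).toMeasure.real {v} = outcomeProb U p v := by
  rw [Measure.real, PMF.toMeasure_apply_singleton _ _ (measurableSet_singleton v)]
  simp only [coin, PMF.ofFintype_apply]
  exact ENNReal.toReal_ofReal (by unfold outcomeProb; positivity)

/-- The probability of prescribed outcomes at finitely many places. -/
theorem flipLaw_real_forall_eq (p : unitInterval) (s : Finset (Fin m × ℕ))
    (x : Fin m × ℕ → Fin 2) :
    (flipLaw G p).real {ω | ∀ i ∈ s, ω i = x i} = ∏ i ∈ s, outcomeProb (G i.1) p (x i) := by
  have : {ω : Flips m | ∀ i ∈ s, ω i = x i} = Set.pi s (fun i => {x i}) := by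
    ext ω; simp [Set.mem_pi]
  rw [this, Measure.real, flipLaw, Measure.infinitePi_pi _ (fun i _ => measurableSet_singleton _),
    ENNReal.toReal_prod]
  exact Finset.prod_congr rfl fun i _ => coin_toMeasure_real _ _ _

theorem realizable_outcomeProb (i : Fin m) (v : Fin 2) :
    Realizable G (fun p => outcomeProb (G i) p v) := by
  intro a
  refine ⟨a + 1, by omega, {ω | ∀ k ∈ ({(i, a)} : Finset (Fin m × ℕ)), ω k = v}, ?_, fun p => ?_⟩
  · intro ω ω' h
    simp [h i a le_rfl (Nat.lt_succ_self a)]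
  · rw [flipLaw_real_forall_eq p _ (fun _ => v)]
    simp

/-! ### Bernoulli factories from a sequence of realizable probabilities -/

/-- A sequence of realizable probabilities is the sequence of probabilities of events that are
determined by consecutive blocks of rounds. -/
theorem exists_events {y : ℕ → unitInterval → ℝ} (hy : ∀ t, Realizable G (y t)) :
    ∃ (N : ℕ → ℕ) (E : ℕ → Set (Flips m)), Monotone N ∧
      (∀ t, DeterminedBy (E t) (N t) (N (t + 1))) ∧
      ∀ t p, (flipLaw G p).real (E t) = y t p := by
  choose b hb E hE hP using hy
  let N : ℕ → ℕ := fun t => Nat.rec 0 (fun t a => b t a) t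
  exact ⟨N, fun t => E t (N t), monotone_nat_of_le_succ fun t => hb t (N t),
    fun t => hE t (N t), fun t => hP t (N t)⟩

/-- The event that none of `E 0, …, E (t - 1)` occurs. -/
def undecided (E : ℕ → Set (Flips m)) (t : ℕ) : Set (Flips m) := {ω | ∀ s < t, ω ∉ E s}

/-- The event that some `E t` occurs and the first such `t` is even. -/
def firstEven (E : ℕ → Set (Flips m)) : Set (Flips m) :=
  {ω | ∃ t, Even t ∧ ω ∈ E t ∧ ω ∈ undecided E t}

/-- The event that one of `E 0, …, E (T - 1)` occurs and the first one has an even index. -/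
def firstEvenBefore (E : ℕ → Set (Flips m)) (T : ℕ) : Set (Flips m) :=
  {ω | ∃ t < T, Even t ∧ ω ∈ E t ∧ ω ∈ undecided E t}

variable {E : ℕ → Set (Flips m)} {N : ℕ → ℕ}

theorem undecided_succ (t : ℕ) : undecided E (t + 1) = undecided E t ∩ (E t)ᶜ := by
  ext ω
  simp only [undecided, Nat.lt_succ_iff_lt_or_eq, or_imp, forall_and, forall_eq,
    Set.mem_ofPred_eq, Set.mem_inter_iff, Set.mem_compl_iff]

theorem determinedBy_undecided (hN : Monotone N)
    (hE : ∀ t, DeterminedBy (E t) (N t) (N (t + 1))) (t : ℕ) :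
    DeterminedBy (undecided E t) 0 (N t) := by
  intro ω ω' h
  refine forall₂_congr fun s hs => not_congr ?_
  exact (hE s).mono (Nat.zero_le _) (hN hs) ω ω' h

theorem determinedBy_firstEvenBefore (hN : Monotone N)
    (hE : ∀ t, DeterminedBy (E t) (N t) (N (t + 1))) (T : ℕ) :
    DeterminedBy (firstEvenBefore E T) 0 (N T) := by
  intro ω ω' h
  refine exists_congr fun t => and_congr_right fun ht => and_congr_right fun _ => and_congr ?_ ?_
  · exact (hE t).mono (Nat.zero_le _) (hN ht) ω ω' h
  · exact (determinedBy_undecided hN hE t).mono le_rfl (hN ht.le) ω ω' h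

theorem measurableSet_firstEven (hN : Monotone N)
    (hE : ∀ t, DeterminedBy (E t) (N t) (N (t + 1))) : MeasurableSet (firstEven E) := by
  have : firstEven E = ⋃ T, firstEvenBefore E T := by
    ext ω
    simp only [firstEven, firstEvenBefore, Set.mem_ofPred_eq, Set.mem_iUnion]
    exact ⟨fun ⟨t, h⟩ => ⟨t + 1, t, Nat.lt_succ_self t, h⟩, fun ⟨_, t, _, h⟩ => ⟨t, h⟩⟩
  rw [this]
  exact MeasurableSet.iUnion fun T => (determinedBy_firstEvenBefore hN hE T).measurableSet

/-- Once some event of the sequence has occurred, membership in `firstEven E` is settled. -/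
theorem mem_firstEven_iff {T : ℕ} {ω : Flips m} (h : ω ∉ undecided E T) :
    ω ∈ firstEven E ↔ ω ∈ firstEvenBefore E T := by
  refine ⟨fun ⟨t, he, ht, hu⟩ => ⟨t, ?_, he, ht, hu⟩, fun ⟨t, _, ht⟩ => ⟨t, ht⟩⟩
  by_contra hlt
  exact h fun s hs => hu s (hs.trans_le (not_lt.1 hlt))

theorem decidedAt_firstEven (hN : Monotone N)
    (hE : ∀ t, DeterminedBy (E t) (N t) (N (t + 1))) {T : ℕ} {ω : Flips m}
    (h : ω ∉ undecided E T) : DecidedAt (firstEven E) ω := by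
  refine ⟨N T, fun ω' hω' => ?_⟩
  have hag : ∀ i j, 0 ≤ j → j < N T → ω' (i, j) = ω (i, j) := fun i j _ hj => hω' i j hj
  have h' : ω' ∉ undecided E T := fun hc => h ((determinedBy_undecided hN hE T ω' ω hag).1 hc)
  rw [mem_firstEven_iff h, mem_firstEven_iff h']
  exact determinedBy_firstEvenBefore hN hE T ω' ω hag

theorem real_undecided (hN : Monotone N) (hE : ∀ t, DeterminedBy (E t) (N t) (N (t + 1)))
    {y : ℕ → unitInterval → ℝ} (hy : ∀ t p, (flipLaw G p).real (E t) = y t p)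
    (p : unitInterval) (T : ℕ) :
    (flipLaw G p).real (undecided E T) = ∏ t ∈ Finset.range T, (1 - y t p) := by
  induction T with
  | zero => simp [undecided]
  | succ T ih =>
    rw [undecided_succ, (determinedBy_undecided hN hE T).real_inter G p (hE T).compl, ih,
      probReal_compl_eq_one_sub (hE T).measurableSet, hy, Finset.prod_range_succ]

/-- If `φ t = y t + (1 - y t) (1 - φ (t + 1))`, then after `T` steps the probability of a positive
decision falls short of `φ 0` by the probability of being undecided times `φ T`, or `1 - φ T` for
odd `T`. -/
theorem real_firstEvenBefore (hN : Monotone N) (hE : ∀ t, DeterminedBy (E t) (N t) (N (t + 1)))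
    {y : ℕ → unitInterval → ℝ} (hy : ∀ t p, (flipLaw G p).real (E t) = y t p)
    (p : unitInterval) {φ : ℕ → ℝ} (hφ : ∀ t, φ (t + 1) * (1 - y t p) = 1 - φ t) (T : ℕ) :
    (flipLaw G p).real (firstEvenBefore E T) +
      (∏ t ∈ Finset.range T, (1 - y t p)) * (if Even T then φ T else 1 - φ T) = φ 0 := by
  induction T with
  | zero => simp [firstEvenBefore]
  | succ T ih =>
    rw [← ih, Finset.prod_range_succ]
    by_cases hT : Even T
    · have hu : firstEvenBefore E (T + 1) = firstEvenBefore E T ∪ (undecided E T ∩ E T) := by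
        ext ω
        simp only [firstEvenBefore, Nat.lt_succ_iff_lt_or_eq, or_and_right, exists_or,
          exists_eq_left, Set.mem_union, Set.mem_ofPred_eq, hT, true_and, Set.mem_inter_iff,
          and_comm]
      have hd : Disjoint (firstEvenBefore E T) (undecided E T ∩ E T) := by
        rw [Set.disjoint_left]
        rintro ω ⟨t, ht, -, htE, -⟩ ⟨hu, -⟩
        exact hu t ht htE
      rw [hu, measureReal_union hd
        ((determinedBy_undecided hN hE T).measurableSet.inter (hE T).measurableSet),
        (determinedBy_undecided hN hE T).real_inter G p (hE T), real_undecided hN hE hy, hy]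
      have hT' : ¬ Even (T + 1) := by simpa [Nat.even_add_one] using hT
      simp only [hT, hT', if_true, if_false]
      linear_combination (-∏ t ∈ Finset.range T, (1 - y t p)) * hφ T
    · have hu : firstEvenBefore E (T + 1) = firstEvenBefore E T := by
        ext ω
        simp only [firstEvenBefore, Nat.lt_succ_iff_lt_or_eq, or_and_right, exists_or,
          exists_eq_left, Set.mem_ofPred_eq, hT, false_and, or_false]
      have hT' : Even (T + 1) := by simpa [Nat.even_add_one] using hT
      rw [hu]
      simp only [hT, hT', if_true, if_false]
      linear_combination (∏ t ∈ Finset.range T, (1 - y t p)) * hφ T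

/-- Conditions under which the first occurrence rule decides almost surely, with the right
probability. -/
theorem exists_event_of_steps {D : Set unitInterval} {y φ : ℕ → unitInterval → ℝ}
    (hy : ∀ t, Realizable G (y t)) (hφ01 : ∀ t, ∀ p ∈ D, φ t p ∈ Set.Icc (0 : ℝ) 1)
    (hφ : ∀ t, ∀ p ∈ D, φ (t + 1) p * (1 - y t p) = 1 - φ t p)
    (hlim : ∀ p ∈ D, Filter.Tendsto (fun T => ∏ t ∈ Finset.range T, (1 - y t p))
      Filter.atTop (nhds 0)) :
    ∃ S : Set (Flips m), MeasurableSet S ∧ ∀ p ∈ D, Discernible (flipLaw G p) S ∧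
      (flipLaw G p).real S = φ 0 p := by
  obtain ⟨N, E, hN, hE, hP⟩ := exists_events hy
  refine ⟨firstEven E, measurableSet_firstEven hN hE, fun p hp => ⟨?_, ?_⟩⟩
  · have hzero : flipLaw G p (⋂ T, undecided E T) = 0 := by
      rw [← measureReal_eq_zero_iff]
      refine le_antisymm (ge_of_tendsto' (hlim p hp) fun T => ?_) measureReal_nonneg
      rw [← real_undecided hN hE hP]
      exact measureReal_mono (Set.iInter_subset _ T)
    filter_upwards [measure_eq_zero_iff_ae_notMem.1 hzero] with ω hω
    obtain ⟨T, hT⟩ := by simpa only [Set.mem_iInter, not_forall] using hω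
    exact decidedAt_firstEven hN hE hT
  · have hbound : ∀ T, |(flipLaw G p).real (firstEven E) - φ 0 p| ≤
        ∏ t ∈ Finset.range T, (1 - y t p) := by
      intro T
      have h1 := real_firstEvenBefore hN hE hP p (φ := fun t => φ t p) (fun t => hφ t p hp) T
      have h2 := real_undecided hN hE hP p T
      have h3 : (flipLaw G p).real (firstEvenBefore E T) ≤ (flipLaw G p).real (firstEven E) :=
        measureReal_mono fun ω ⟨t, _, ht⟩ => ⟨t, ht⟩
      have h4 : (flipLaw G p).real (firstEven E) ≤
          (flipLaw G p).real (firstEvenBefore E T) + (flipLaw G p).real (undecided E T) := by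
        refine (measureReal_mono fun ω hω => ?_).trans (measureReal_union_le _ _)
        by_cases hu : ω ∈ undecided E T
        · exact Or.inr hu
        · exact Or.inl ((mem_firstEven_iff hu).1 hω)
      have h5 : (if Even T then φ T p else 1 - φ T p) ∈ Set.Icc (0 : ℝ) 1 := by
        have := hφ01 T p hp
        split_ifs
        · exact this
        · exact ⟨by linarith [this.2], by linarith [this.1]⟩
      have h6 : 0 ≤ ∏ t ∈ Finset.range T, (1 - y t p) := h2 ▸ measureReal_nonneg
      rw [abs_le]
      constructor <;> nlinarith [mul_nonneg h6 h5.1, mul_le_mul_of_nonneg_left h5.2 h6]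
    have := ge_of_tendsto' (hlim p hp) hbound
    exact sub_eq_zero.1 (abs_eq_zero.1 (le_antisymm this (abs_nonneg _)))

end Realizable


/-! ### Rounded Bernstein polynomials -/

section Bernstein

variable {m : ℕ} {G : Fin m → Matrix.unitaryGroup (Fin 2) ℂ} {i : Fin m}

theorem outcomeProb_one_eq (U : Matrix.unitaryGroup (Fin 2) ℂ) (p : unitInterval) :
    outcomeProb U p 1 = 1 - outcomeProb U p 0 := by
  have := sum_outcomeProb U p
  rw [Fin.sum_univ_two] at this
  linarith

/-- If the `i`-th coin shows `0` with probability `p`, then the set of times `j < n` at which it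
shows `0` lies in the family `𝒜` with probability `∑ s ∈ 𝒜, p ^ #s * (1 - p) ^ (n - #s)`. -/
theorem realizable_sum_pattern (hi : ∀ p, outcomeProb (G i) p 0 = p) (n : ℕ)
    (𝒜 : Finset (Finset ℕ)) (h𝒜 : ∀ s ∈ 𝒜, s ⊆ Finset.range n) :
    Realizable G (fun p => ∑ s ∈ 𝒜, (p : ℝ) ^ s.card * (1 - (p : ℝ)) ^ (n - s.card)) := by
  intro a
  let pos : ℕ ↪ Fin m × ℕ := ⟨fun j => (i, a + j), fun j k h => by simpa using h⟩
  let x : Finset ℕ → Fin m × ℕ → Fin 2 := fun s k => if k.2 - a ∈ s then 0 else 1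
  let C : Finset ℕ → Set (Flips m) := fun s => {ω | ∀ k ∈ (Finset.range n).map pos, ω k = x s k}
  have hx : ∀ s j, x s (pos j) = if j ∈ s then 0 else 1 := fun s j => by
    change (if a + j - a ∈ s then (0 : Fin 2) else 1) = _
    rw [Nat.add_sub_cancel_left]
  have hC : ∀ s, DeterminedBy (C s) a (a + n) := by
    intro s ω ω' h
    simp only [C, Set.mem_ofPred_eq, Finset.forall_mem_map, Finset.mem_range]
    refine forall₂_congr fun j hj => ?_
    rw [show ω (pos j) = ω' (pos j) from h i (a + j) (by omega) (by omega)]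
  refine ⟨a + n, by omega, ⋃ s ∈ 𝒜, C s, ?_, fun p => ?_⟩
  · intro ω ω' h
    simp only [Set.mem_iUnion]
    exact exists₂_congr fun s _ => hC s ω ω' h
  · rw [measureReal_biUnion_finset]
    · refine Finset.sum_congr rfl fun s hs => ?_
      rw [flipLaw_real_forall_eq, Finset.prod_map]
      have : ∀ j ∈ Finset.range n, outcomeProb (G (pos j).1) p (x s (pos j)) =
          if j ∈ s then (p : ℝ) else 1 - p := by
        intro j _
        change outcomeProb (G i) p (x s (pos j)) = _
        rw [hx]
        split_ifs
        · exact hi p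
        · rw [outcomeProb_one_eq, hi]
      rw [Finset.prod_congr rfl this, Finset.prod_ite, Finset.prod_const, Finset.prod_const,
        Finset.filter_mem_eq_inter, Finset.inter_eq_right.2 (h𝒜 s hs), Finset.filter_notMem_eq_sdiff,
        Finset.card_sdiff_of_subset (h𝒜 s hs), Finset.card_range]
    · intro s hs s' hs' hne
      refine Set.disjoint_left.2 fun ω h h' => hne ?_
      ext j
      by_cases hj : j < n
      · have h1 := h (pos j) (by simpa using hj)
        have h2 := h' (pos j) (by simpa using hj)
        have h3 : x s (pos j) = x s' (pos j) := h1.symm.trans h2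
        rw [hx, hx] at h3
        by_cases hs : j ∈ s <;> by_cases hs' : j ∈ s' <;> simp [hs, hs'] at h3 ⊢
      · exact iff_of_false (fun h => hj (Finset.mem_range.1 (h𝒜 s hs h)))
          (fun h => hj (Finset.mem_range.1 (h𝒜 s' hs' h)))
    · exact fun s _ => (hC s).measurableSet

/-- Bernstein-type sums whose integer coefficients are at most the binomial ones are realizable: accept
`N j` of the `n.choose j` patterns with `j` zeros. -/
theorem realizable_sum_natCast_mul (hi : ∀ p, outcomeProb (G i) p 0 = p) (n : ℕ) (N : ℕ → ℕ)
    (hN : ∀ j, N j ≤ n.choose j) :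
    Realizable G (fun p => ∑ j ∈ Finset.range (n + 1),
      (N j : ℝ) * ((p : ℝ) ^ j * (1 - (p : ℝ)) ^ (n - j))) := by
  have : ∀ j, ∃ B ⊆ Finset.powersetCard j (Finset.range n), B.card = N j := fun j =>
    Finset.exists_subset_card_eq (by simpa using hN j)
  choose B hB hcard using this
  have hmem : ∀ {j s}, s ∈ B j → s ⊆ Finset.range n ∧ s.card = j := fun h =>
    Finset.mem_powersetCard.1 (hB _ h)
  have h := realizable_sum_pattern hi n ((Finset.range (n + 1)).biUnion B) (by
    intro s hs
    obtain ⟨j, -, hj⟩ := Finset.mem_biUnion.1 hs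
    exact (hmem hj).1)
  convert! h using 2 with p
  rw [Finset.sum_biUnion]
  · refine Finset.sum_congr rfl fun j _ => ?_
    rw [Finset.sum_congr rfl fun s hs => by rw [(hmem hs).2], Finset.sum_const, hcard, nsmul_eq_mul]
  · intro j _ j' _ hne
    exact Finset.disjoint_left.2 fun s h h' => hne ((hmem h).2.symm.trans (hmem h').2)

/-- Uniform approximation on compact subintervals of `(0,1)`. -/
theorem exists_realizable_approx (hi : ∀ p, outcomeProb (G i) p 0 = p) (F : C(unitInterval, ℝ))
    (hF : ∀ x, F x ∈ Set.Icc (0 : ℝ) 1) {θ δ : ℝ} (hθ : 0 < θ) (hδ : 0 < δ) :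
    ∃ g, Realizable G g ∧ Continuous g ∧
      ∀ p : unitInterval, θ ≤ p → θ ≤ 1 - p → |g p - F p| ≤ δ := by
  by_cases hθ1 : 1 < θ
  · exact ⟨_, Realizable.one, continuous_const, fun p hp _ =>
      absurd p.2.2 (not_le.2 (hθ1.trans_le hp))⟩
  have hθ1 := not_lt.1 hθ1
  -- Rounding changes each of the `n + 1` coefficients by at most `1`, and the coefficient is
  -- multiplied by `p ^ j * (1 - p) ^ (n - j) ≤ (1 - θ) ^ n`.
  have hlim : Filter.Tendsto (fun n : ℕ => ((n : ℝ) + 1) * (1 - θ) ^ n) Filter.atTop (nhds 0) := by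
    have h0 : (0 : ℝ) ≤ 1 - θ := by linarith
    have h1 : 1 - θ < 1 := by linarith
    have := (tendsto_self_mul_const_pow_of_lt_one h0 h1).add
      (tendsto_pow_atTop_nhds_zero_of_lt_one h0 h1)
    simpa [add_mul] using this
  obtain ⟨n, hn1, hn2⟩ := ((hlim.eventually_lt_const (half_pos hδ)).and
    ((Metric.tendsto_nhds.1 (bernsteinApproximation_uniform F)) _ (half_pos hδ))).exists
  let cf : ℕ → ℝ := fun j => if h : j < n + 1 then F (bernstein.z ⟨j, h⟩) else 0
  have hcf : ∀ j, cf j ∈ Set.Icc (0 : ℝ) 1 := by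
    intro j
    by_cases h : j < n + 1
    · simp only [cf, dif_pos h]
      exact hF _
    · simp only [cf, dif_neg h]
      exact ⟨le_rfl, zero_le_one⟩
  have hcf0 : ∀ j, 0 ≤ cf j * n.choose j := fun j => mul_nonneg (hcf j).1 (Nat.cast_nonneg _)
  have hreal := realizable_sum_natCast_mul hi n (fun j => ⌊cf j * n.choose j⌋₊) (fun j => by
    have h : cf j * n.choose j ≤ n.choose j :=
      mul_le_of_le_one_left (Nat.cast_nonneg _) (hcf j).2
    simpa using Nat.floor_le_floor h)
  refine ⟨_, hreal, by fun_prop, fun p hp1 hp2 => ?_⟩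
  have hB : bernsteinApproximation n F p = ∑ j ∈ Finset.range (n + 1),
      (cf j * n.choose j) * ((p : ℝ) ^ j * (1 - (p : ℝ)) ^ (n - j)) := by
    rw [bernsteinApproximation.apply, Finset.sum_range]
    refine Finset.sum_congr rfl fun j _ => ?_
    simp only [bernstein_apply, cf, j.2, dif_pos, smul_eq_mul, Fin.eta]
    ring
  have h1 : |bernsteinApproximation n F p - F p| < δ / 2 := by
    have := (ContinuousMap.dist_apply_le_dist p).trans_lt hn2
    rwa [Real.dist_eq] at this
  have h2 : |∑ j ∈ Finset.range (n + 1), ((⌊cf j * n.choose j⌋₊ : ℕ) : ℝ) *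
      ((p : ℝ) ^ j * (1 - (p : ℝ)) ^ (n - j)) - bernsteinApproximation n F p| ≤
      ((n : ℝ) + 1) * (1 - θ) ^ n := by
    rw [hB, ← Finset.sum_sub_distrib]
    refine (Finset.abs_sum_le_sum_abs _ _).trans ?_
    have : ∀ j ∈ Finset.range (n + 1), |((⌊cf j * n.choose j⌋₊ : ℕ) : ℝ) *
        ((p : ℝ) ^ j * (1 - (p : ℝ)) ^ (n - j)) -
        (cf j * n.choose j) * ((p : ℝ) ^ j * (1 - (p : ℝ)) ^ (n - j))| ≤ (1 - θ) ^ n := by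
      intro j hj
      have hp0 : (0 : ℝ) ≤ p := p.2.1
      have hp0' : (0 : ℝ) ≤ 1 - p := sub_nonneg.2 p.2.2
      have hw : (p : ℝ) ^ j * (1 - (p : ℝ)) ^ (n - j) ≤ (1 - θ) ^ n := by
        calc (p : ℝ) ^ j * (1 - (p : ℝ)) ^ (n - j) ≤ (1 - θ) ^ j * (1 - θ) ^ (n - j) :=
              mul_le_mul (pow_le_pow_left₀ hp0 (by linarith) j)
                (pow_le_pow_left₀ hp0' (by linarith) _) (by positivity)
                (pow_nonneg (by linarith) _)
          _ = (1 - θ) ^ n := by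
              rw [← pow_add, Nat.add_sub_cancel' (Nat.lt_succ_iff.1 (Finset.mem_range.1 hj))]
      have hr : |((⌊cf j * n.choose j⌋₊ : ℕ) : ℝ) - cf j * n.choose j| ≤ 1 := by
        rw [abs_le]
        exact ⟨by linarith [Nat.lt_floor_add_one (cf j * n.choose j)],
          by linarith [Nat.floor_le (hcf0 j)]⟩
      rw [← sub_mul, abs_mul, abs_of_nonneg (by positivity : 0 ≤ (p : ℝ) ^ j * (1 - p) ^ (n - j))]
      exact (mul_le_of_le_one_left (by positivity) hr).trans hw
    refine (Finset.sum_le_sum this).trans (le_of_eq ?_)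
    rw [Finset.sum_const, Finset.card_range, nsmul_eq_mul]
    push_cast
    rfl
  have h3 := abs_sub_le (∑ j ∈ Finset.range (n + 1), ((⌊cf j * n.choose j⌋₊ : ℕ) : ℝ) *
      ((p : ℝ) ^ j * (1 - (p : ℝ)) ^ (n - j))) (bernsteinApproximation n F p) (F p)
  linarith

/-- On a compact subset of `(0,1)` where it is continuous and bounded below by a positive constant,
a function is comparable to a realizable one. -/
theorem exists_realizable_between (hi : ∀ p, outcomeProb (G i) p 0 = p) {K : Set unitInterval}
    (hK : IsClosed K) {φ : unitInterval → ℝ} (hφ : ContinuousOn φ K) {θ δ : ℝ} (hθ : 0 < θ)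
    (hKθ : ∀ p ∈ K, θ ≤ p ∧ θ ≤ 1 - p) (hδ : 0 < δ) (hφδ : ∀ p ∈ K, δ ≤ φ p)
    (hφ1 : ∀ p ∈ K, φ p ≤ 1) :
    ∃ g, Realizable G g ∧ Continuous g ∧ ∀ p ∈ K, φ p / 8 ≤ g p ∧ g p ≤ φ p / 2 := by
  obtain ⟨F, hF01, hF⟩ := ContinuousMap.exists_forall_mem_restrict_eq hK
    (⟨fun p : K => φ p / 4, (hφ.domRestrict).div_const 4⟩ : C(K, ℝ)) (t := Set.Icc (0 : ℝ) 1)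
    (fun p => ⟨by change 0 ≤ φ p / 4; linarith [hφδ p p.2],
      by change φ p / 4 ≤ 1; linarith [hφ1 p p.2]⟩)
  obtain ⟨g, hg, hgc, hgF⟩ := exists_realizable_approx hi F hF01 hθ (δ := δ / 8) (by linarith)
  refine ⟨g, hg, hgc, fun p hp => ?_⟩
  have h1 : F p = φ p / 4 := congrArg (fun f : C(K, ℝ) => f ⟨p, hp⟩) hF
  have h2 := abs_le.1 (hgF p (hKθ p hp).1 (hKθ p hp).2)
  have h3 := hφδ p hp
  constructor <;> linarith [h2.1, h2.2]

end Bernstein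


/-! ### The coins `p` and `h_c` -/

theorem outcomeProb_hadamard_zero (p : unitInterval) : outcomeProb (hadamard 0) p 0 = p := by
  simp [outcomeProb, hadamard, quoin, Matrix.mulVec, dotProduct, Fin.sum_univ_two,
    Real.sq_sqrt p.2.1]

theorem outcomeProb_hadamard_symm (c p : unitInterval) :
    outcomeProb (hadamard (unitInterval.symm c)) p 1 = hFun c p := by
  have hc : (0 : ℝ) ≤ c := c.2.1
  have hp : (0 : ℝ) ≤ p := p.2.1
  have h : ((hadamard (unitInterval.symm c) : Matrix (Fin 2) (Fin 2) ℂ) *ᵥ quoin p) 1 =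
      ((Real.sqrt (p * (1 - c)) - Real.sqrt (c * (1 - p)) : ℝ) : ℂ) := by
    rw [Real.sqrt_mul hp, Real.sqrt_mul hc]
    simp [hadamard, quoin, Matrix.mulVec, dotProduct, Fin.sum_univ_two]
    ring
  rw [outcomeProb, h, Complex.norm_real, hFun, Real.norm_eq_abs, sq_abs]

theorem hFun_pos {c p : unitInterval} (h : c ≠ p) : 0 < hFun c p := by
  have hc : (0 : ℝ) ≤ c := c.2.1
  have hp : (0 : ℝ) ≤ p := p.2.1
  have hc' : (0 : ℝ) ≤ 1 - c := sub_nonneg.2 c.2.2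
  have hp' : (0 : ℝ) ≤ 1 - p := sub_nonneg.2 p.2.2
  refine sq_pos_of_ne_zero (sub_ne_zero.2 fun he => h ?_)
  rw [Real.sqrt_inj (by positivity) (by positivity)] at he
  exact Subtype.ext (by linarith)

theorem hFun_self (c : ℝ) : hFun c c = 0 := by simp [hFun]

theorem one_sub_hFun (c p : unitInterval) :
    1 - hFun c p = (Real.sqrt (p * c) + Real.sqrt ((1 - p) * (1 - c))) ^ 2 := by
  have hc : (0 : ℝ) ≤ c := c.2.1
  have hp : (0 : ℝ) ≤ p := p.2.1
  have hc' : (0 : ℝ) ≤ 1 - c := sub_nonneg.2 c.2.2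
  have hp' : (0 : ℝ) ≤ 1 - p := sub_nonneg.2 p.2.2
  rw [hFun, Real.sqrt_mul hp, Real.sqrt_mul hc, Real.sqrt_mul hp, Real.sqrt_mul hp']
  have h1 := Real.sq_sqrt hc
  have h2 := Real.sq_sqrt hp
  have h3 := Real.sq_sqrt hc'
  have h4 := Real.sq_sqrt hp'
  ring_nf
  rw [h1, h2, h3, h4]
  ring

theorem one_sub_hFun_pos {c p : unitInterval} (h : (0 : ℝ) < p * c + (1 - p) * (1 - c)) :
    0 < 1 - hFun c p := by
  have hc : (0 : ℝ) ≤ c := c.2.1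
  have hp : (0 : ℝ) ≤ p := p.2.1
  have hc' : (0 : ℝ) ≤ 1 - c := sub_nonneg.2 c.2.2
  have hp' : (0 : ℝ) ≤ 1 - p := sub_nonneg.2 p.2.2
  rw [one_sub_hFun]
  refine sq_pos_of_pos ?_
  rcases (mul_nonneg hp hc).lt_or_eq with h1 | h1
  · exact add_pos_of_pos_of_nonneg (Real.sqrt_pos.2 h1) (Real.sqrt_nonneg _)
  · exact add_pos_of_nonneg_of_pos (Real.sqrt_nonneg _) (Real.sqrt_pos.2 (by linarith))

/-- `∏ h_c(p) (1 - h_c(p))`, the product over the list `l` of the points `c`. -/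
def hProd (l : List unitInterval) (p : unitInterval) : ℝ :=
  (l.map fun c : unitInterval => hFun c p * (1 - hFun c p)).prod

/-- `p (1 - p) ∏ h_c(p) (1 - h_c(p))`: the function `aFun` for lists in `[0,1]`. -/
def aProd (l : List unitInterval) (p : unitInterval) : ℝ := p * (1 - p) * hProd l p

theorem aFun_map_coe (l : List unitInterval) (p : unitInterval) :
    aFun (l.map (↑)) p = aProd l p := by
  simp [aFun, aProd, hProd]

theorem hFun_mem_Icc (c p : unitInterval) : hFun c p ∈ Set.Icc (0 : ℝ) 1 := by
  refine ⟨sq_nonneg _, ?_⟩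
  have := one_sub_hFun c p ▸ sq_nonneg (Real.sqrt (p * c) + Real.sqrt ((1 - p) * (1 - c)))
  linarith

theorem hProd_mem_Icc (l : List unitInterval) (p : unitInterval) :
    hProd l p ∈ Set.Icc (0 : ℝ) 1 := by
  induction l with
  | nil => simp [hProd]
  | cons c l ih =>
    have h := hFun_mem_Icc c p
    have h' : hFun c p * (1 - hFun c p) ∈ Set.Icc (0 : ℝ) 1 :=
      unitInterval.mul_mem h ⟨by linarith [h.2], by linarith [h.1]⟩
    simpa [hProd] using unitInterval.mul_mem h' ih

theorem hProd_pos {l : List unitInterval} {p : unitInterval} (hp : ∀ c ∈ l, c ≠ p)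
    (h : ∀ c ∈ l, (0 : ℝ) < p * c + (1 - p) * (1 - c)) : 0 < hProd l p := by
  refine List.prod_pos fun x hx => ?_
  obtain ⟨c, hc, rfl⟩ := List.mem_map.1 hx
  exact mul_pos (hFun_pos (hp c hc)) (one_sub_hFun_pos (h c hc))

theorem hProd_filter_mul (l : List unitInterval) (P : unitInterval → Bool) (p : unitInterval) :
    hProd l p = hProd (l.filter P) p * hProd (l.filter fun c => !P c) p := by
  induction l with
  | nil => simp [hProd]
  | cons c l ih =>
    have h : hProd (c :: l) p = hFun c p * (1 - hFun c p) * hProd l p := by simp [hProd]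
    rw [h, ih]
    cases hc : P c <;> simp [hProd, hc] <;> ring

theorem continuous_hProd (l : List unitInterval) : Continuous (hProd l) := by
  refine continuous_list_prod l fun c _ => ?_
  unfold hFun
  fun_prop

theorem continuous_aProd (l : List unitInterval) : Continuous (aProd l) := by
  have := continuous_hProd l
  unfold aProd
  fun_prop

theorem aProd_nonneg (l : List unitInterval) (p : unitInterval) : 0 ≤ aProd l p :=
  mul_nonneg (mul_nonneg p.2.1 (sub_nonneg.2 p.2.2)) (hProd_mem_Icc l p).1

theorem aProd_le (l : List unitInterval) (p : unitInterval) : aProd l p ≤ p :=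
  (mul_le_of_le_one_right (mul_nonneg p.2.1 (sub_nonneg.2 p.2.2)) (hProd_mem_Icc l p).2).trans
    (mul_le_of_le_one_right p.2.1 (by linarith [p.2.1]))

theorem aProd_le_one_sub (l : List unitInterval) (p : unitInterval) : aProd l p ≤ 1 - p :=
  (mul_le_of_le_one_right (mul_nonneg p.2.1 (sub_nonneg.2 p.2.2)) (hProd_mem_Icc l p).2).trans
    (mul_le_of_le_one_left (sub_nonneg.2 p.2.2) p.2.2)

theorem aProd_pos {l : List unitInterval} {p : unitInterval} (h0 : (0 : ℝ) < p) (h1 : (p : ℝ) < 1)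
    (hp : ∀ c ∈ l, c ≠ p) : 0 < aProd l p := by
  refine mul_pos (mul_pos h0 (sub_pos.2 h1)) (hProd_pos hp fun c _ => ?_)
  rcases (show (0 : ℝ) ≤ c from c.2.1).lt_or_eq with hc | hc
  · nlinarith [mul_pos h0 hc, c.2.2]
  · rw [← hc]; linarith

theorem aProd_eq_zero_of_mem {l : List unitInterval} {p : unitInterval} (hp : p ∈ l) :
    aProd l p = 0 := by
  have : hProd l p = 0 := List.prod_eq_zero (List.mem_map.2 ⟨p, hp, by simp [hFun_self]⟩)
  simp [aProd, this]

theorem realizable_aProd {m : ℕ} {G : Fin m → Matrix.unitaryGroup (Fin 2) ℂ}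
    {l : List unitInterval} (hG0 : Realizable G (fun p => (p : ℝ)))
    (hG : ∀ c ∈ l, Realizable G (fun p => hFun c p)) : Realizable G (aProd l) :=
  (hG0.mul hG0.compl).mul
    (Realizable.list_prod l (fun c p => hFun c p * (1 - hFun c p)) fun c hc =>
      (hG c hc).mul (hG c hc).compl)

/-! ### One step of the factory -/

section Step

variable {D : Set unitInterval} {L : List unitInterval} {φ : unitInterval → ℝ}

open Classical in
/-- The points of `L` that lie off `D` or at which `φ` is small. -/
def badPoints (D : Set unitInterval) (L : List unitInterval) (φ : unitInterval → ℝ) :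
    List unitInterval :=
  L.filter fun c => decide (c ∉ D ∨ φ c < 1 / 4)

theorem mem_badPoints {c : unitInterval} :
    c ∈ badPoints D L φ ↔ c ∈ L ∧ (c ∉ D ∨ φ c < 1 / 4) := by
  classical simp [badPoints]

/-- A point of `L` in `D` at which `φ` is not small can be dropped from `L`, at the cost of a
constant factor: `φ` is bounded below near that point, and the factor that belongs to it is
bounded below elsewhere. -/
theorem exists_mul_badPoints_le (hD : IsOpen D) (hD01 : ∀ p ∈ D, (0 : ℝ) < p ∧ (p : ℝ) < 1)
    (hφ : ContinuousOn φ D) {k : ℕ} {κ : ℝ} (hκ : 0 < κ)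
    (hbound : ∀ p ∈ D, κ * aProd L p ^ k ≤ φ p) :
    ∃ κ' > 0, ∀ p ∈ D, κ' * aProd (badPoints D L φ) p ^ k ≤ φ p := by
  classical
  set Z := badPoints D L φ with hZ
  set R := L.filter fun c => !decide (c ∉ D ∨ φ c < 1 / 4) with hR
  have hRmem : ∀ c ∈ R, c ∈ D ∧ 1 / 4 ≤ φ c := by
    intro c hc
    simpa using (List.mem_filter.1 hc).2
  have hsplit : ∀ p, aProd L p = aProd Z p * hProd R p := by
    intro p
    rw [aProd, aProd, hProd_filter_mul L (fun c => decide (c ∉ D ∨ φ c < 1 / 4)) p, mul_assoc _ _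
      (hProd R p)]
    rfl
  have hU : IsOpen (D ∩ φ ⁻¹' Set.Ioi (1 / 8)) := hφ.isOpen_inter_preimage hD isOpen_Ioi
  obtain ⟨μ, hμ, hRμ⟩ := hU.isClosed_compl.isCompact.exists_forall_le'
    (continuous_hProd R).continuousOn (a := 0) (fun p hp => by
      refine hProd_pos (fun c hc he => hp ?_) (fun c hc => ?_)
      · obtain ⟨h1, h2⟩ := hRmem c hc
        rw [← he]
        exact ⟨h1, by simp only [Set.mem_preimage, Set.mem_Ioi]; linarith⟩
      · obtain ⟨h1, h2⟩ := hD01 c (hRmem c hc).1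
        have hp0 : (0 : ℝ) ≤ p := p.2.1
        rcases hp0.lt_or_eq with h | h
        · nlinarith [mul_pos h h1, p.2.2]
        · rw [← h]; linarith)
  refine ⟨min (1 / 8) (κ * μ ^ k), by positivity, fun p hp => ?_⟩
  have ha0 : 0 ≤ aProd Z p := aProd_nonneg _ _
  have ha1 : aProd Z p ≤ 1 := (aProd_le _ _).trans p.2.2
  by_cases hpU : p ∈ D ∩ φ ⁻¹' Set.Ioi (1 / 8)
  · have h1 : 1 / 8 < φ p := hpU.2
    have h2 : aProd Z p ^ k ≤ 1 := pow_le_one₀ ha0 ha1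
    calc _ ≤ 1 / 8 * aProd Z p ^ k :=
          mul_le_mul_of_nonneg_right (min_le_left _ _) (pow_nonneg ha0 k)
      _ ≤ φ p := by linarith
  · calc _ ≤ κ * μ ^ k * aProd Z p ^ k :=
          mul_le_mul_of_nonneg_right (min_le_right _ _) (pow_nonneg ha0 k)
      _ = κ * (aProd Z p * μ) ^ k := by ring
      _ ≤ κ * aProd L p ^ k := by
          rw [hsplit]
          gcongr
          exact hRμ p hpU
      _ ≤ φ p := hbound p hp

variable {m : ℕ} {G : Fin m → Matrix.unitaryGroup (Fin 2) ℂ} {i : Fin m}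

/-- A realizable `y ≤ φ / 2` that is bounded below at the points of the compact set `K` where `φ` is
not small. -/
theorem exists_step (hD : IsOpen D) (hD01 : ∀ p ∈ D, (0 : ℝ) < p ∧ (p : ℝ) < 1)
    (hDL : ∀ p : unitInterval, (0 : ℝ) < p → (p : ℝ) < 1 → p ∉ D → p ∈ L)
    (hi : ∀ p, outcomeProb (G i) p 0 = p) (hG : ∀ c ∈ L, Realizable G (fun p => hFun c p))
    (hφ : ContinuousOn φ D) {k : ℕ} {κ : ℝ} (hκ : 0 < κ)
    (hbound : ∀ p ∈ D, κ * aProd L p ^ k ≤ φ p) (hφ1 : ∀ p ∈ D, φ p ≤ 1)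
    {K : Set unitInterval} (hK : IsClosed K) (hKD : K ⊆ D) :
    ∃ y, Realizable G y ∧ Continuous y ∧ (∀ p ∈ D, y p ≤ φ p / 2) ∧
      ∀ p ∈ K, 1 / 2 ≤ φ p → 1 / 32 ≤ y p := by
  set Z := badPoints D L φ with hZ
  have hG0 : Realizable G (fun p => (p : ℝ)) := by
    have := realizable_outcomeProb (G := G) i 0
    simpa only [hi] using this
  have hZr : Realizable G (aProd Z) :=
    realizable_aProd hG0 fun c hc => hG c (mem_badPoints.1 hc).1
  have hZc := continuous_aProd Z
  have hZ0 : ∀ p, 0 ≤ aProd Z p := aProd_nonneg Z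
  obtain ⟨κ', hκ', hbound'⟩ := exists_mul_badPoints_le (L := L) hD hD01 hφ hκ hbound
  have hQ : IsClosed (K ∩ φ ⁻¹' Set.Ici (1 / 2)) :=
    (hφ.mono hKD).preimage_isClosed_of_isClosed hK isClosed_Ici
  obtain ⟨ε, hε, hQε⟩ := hQ.isCompact.exists_forall_le' hZc.continuousOn (a := 0) (fun p hp => by
    obtain ⟨h0, h1⟩ := hD01 p (hKD hp.1)
    refine aProd_pos h0 h1 fun c hc he => ?_
    subst he
    have h2 : 1 / 2 ≤ φ c := hp.2
    rcases (mem_badPoints.1 hc).2 with h | h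
    · exact h (hKD hp.1)
    · linarith)
  -- `ε > 1` is possible only if no point of `K` has `φ p ≥ 1/2`; then `y = 0` will do.
  by_cases hε1 : 1 < ε
  · refine ⟨fun _ => 1 - 1, Realizable.one.compl, by fun_prop, fun p hp => ?_, fun p hp h => ?_⟩
    · have := hbound p hp
      have := mul_nonneg hκ.le (pow_nonneg (aProd_nonneg L p) k)
      simp only [sub_self]
      linarith
    · linarith [hQε p ⟨hp, h⟩, aProd_le Z p, p.2.2]
  have hε1 : ε ≤ 1 := not_lt.1 hε1
  -- `w` is at least `1/2` at the points of `K` with `φ p ≥ 1/2`, where `aProd Z ≥ ε`, and at most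
  -- `φ / 2` where `aProd Z < η`.
  obtain ⟨M, hM⟩ := exists_pow_lt_of_lt_one (show (0 : ℝ) < 1 / 2 by norm_num)
    (show 1 - ε ^ (k + 1) < 1 by linarith [pow_pos hε (k + 1)])
  set w : unitInterval → ℝ := fun p => 1 - (1 - aProd Z p ^ (k + 1)) ^ M with hw
  have hwr : Realizable G w := ((hZr.pow (k + 1)).compl.pow M).compl
  have hwM : ∀ p, w p ≤ M * aProd Z p ^ (k + 1) := by
    intro p
    have h1 : aProd Z p ^ (k + 1) ≤ 1 := pow_le_one₀ (hZ0 p) ((aProd_le Z p).trans p.2.2)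
    have := one_add_mul_le_pow (show (-2 : ℝ) ≤ -aProd Z p ^ (k + 1) by linarith) M
    rw [← sub_eq_add_neg] at this
    simp only [hw]
    linarith
  have hwQ : ∀ p, ε ≤ aProd Z p → 1 / 2 ≤ w p := by
    intro p hp
    have h1 : aProd Z p ^ (k + 1) ≤ 1 := pow_le_one₀ (hZ0 p) ((aProd_le Z p).trans p.2.2)
    have h2 : ε ^ (k + 1) ≤ aProd Z p ^ (k + 1) := pow_le_pow_left₀ hε.le hp _
    have h3 : (1 - aProd Z p ^ (k + 1)) ^ M ≤ (1 - ε ^ (k + 1)) ^ M :=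
      pow_le_pow_left₀ (by linarith) (by linarith) _
    simp only [hw]
    linarith
  obtain ⟨η, hη, hηε, hηM⟩ : ∃ η : ℝ, 0 < η ∧ η ≤ ε ∧ M * η ≤ κ' / 2 := by
    refine ⟨min ε (κ' / 2 / (M + 1)), by positivity, min_le_left _ _, ?_⟩
    calc (M : ℝ) * min ε (κ' / 2 / (M + 1)) ≤ (M + 1) * (κ' / 2 / (M + 1)) :=
          mul_le_mul (by linarith) (min_le_right _ _) (by positivity) (by positivity)
      _ = κ' / 2 := by field_simp
  have hK'D : ∀ p, η ≤ aProd Z p → p ∈ D := by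
    intro p hp
    by_contra hpD
    have h0 : (0 : ℝ) < p := by linarith [aProd_le Z p]
    have h1 : (p : ℝ) < 1 := by linarith [aProd_le_one_sub Z p]
    have := aProd_eq_zero_of_mem (mem_badPoints.2 ⟨hDL p h0 h1 hpD, Or.inl hpD⟩ : p ∈ Z)
    linarith
  obtain ⟨g, hg, hgc, hgφ⟩ := exists_realizable_between hi (K := {p | η ≤ aProd Z p})
    (isClosed_le continuous_const hZc) (hφ.mono hK'D) hη
    (fun p hp => ⟨hp.out.trans (aProd_le Z p), hp.out.trans (aProd_le_one_sub Z p)⟩)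
    (show 0 < κ' * η ^ k by positivity)
    (fun p hp => (mul_le_mul_of_nonneg_left (pow_le_pow_left₀ hη.le hp.out k) hκ'.le).trans
      (hbound' p (hK'D p hp)))
    (fun p hp => hφ1 p (hK'D p hp))
  refine ⟨fun p => w p * g p, hwr.mul hg, by fun_prop, fun p hp => ?_, fun p hp h => ?_⟩
  · by_cases hpη : η ≤ aProd Z p
    · exact (mul_le_of_le_one_left (hg.nonneg p) (hwr.le_one p)).trans (hgφ p hpη).2
    · calc w p * g p ≤ w p := mul_le_of_le_one_right (hwr.nonneg p) (hg.le_one p)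
        _ ≤ M * aProd Z p ^ (k + 1) := hwM p
        _ = M * aProd Z p * aProd Z p ^ k := by ring
        _ ≤ M * η * aProd Z p ^ k := by
            have := hZ0 p
            gcongr
            exact (not_le.1 hpη).le
        _ ≤ κ' / 2 * aProd Z p ^ k := mul_le_mul_of_nonneg_right hηM (pow_nonneg (hZ0 p) k)
        _ ≤ φ p / 2 := by linarith [hbound' p hp]
  · have h1 := hQε p ⟨hp, h⟩
    have h2 := hwQ p h1
    have h3 := (hgφ p (hηε.trans h1)).1
    calc (1 / 32 : ℝ) = 1 / 2 * (1 / 16) := by norm_num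
      _ ≤ w p * g p := mul_le_mul h2 (by linarith) (by norm_num) (by linarith)

end Step

/-! ### Iteration -/

/-- If the remaining probability loses a fixed proportion every two steps from some time on, it
tends to zero. -/
theorem tendsto_prod_one_sub {y : ℕ → ℝ} {δ : ℝ} (hδ : 0 < δ) (h0 : ∀ t, 0 ≤ y t)
    (h1 : ∀ t, y t ≤ 1) {T₀ : ℕ} (h : ∀ t ≥ T₀, δ ≤ y t ∨ δ ≤ y (t + 1)) :
    Filter.Tendsto (fun T => ∏ t ∈ Finset.range T, (1 - y t)) Filter.atTop (nhds 0) := by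
  set u : ℕ → ℝ := fun T => ∏ t ∈ Finset.range T, (1 - y t) with hu
  have hu0 : ∀ T, 0 ≤ u T := fun T => Finset.prod_nonneg fun t _ => sub_nonneg.2 (h1 t)
  have hsucc : ∀ T, u (T + 1) = u T * (1 - y T) := fun T => Finset.prod_range_succ _ _
  have hanti : Antitone u := antitone_nat_of_succ_le fun T => by
    rw [hsucc]
    exact mul_le_of_le_one_right (hu0 T) (by linarith [h0 T])
  have hlim := tendsto_atTop_ciInf hanti ⟨0, by rintro _ ⟨T, rfl⟩; exact hu0 T⟩
  set ℓ := ⨅ T, u T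
  have hℓ0 : 0 ≤ ℓ := ge_of_tendsto' hlim hu0
  have hstep : ∀ᶠ T in Filter.atTop, u (T + 2) ≤ (1 - δ) * u T := by
    filter_upwards [Filter.eventually_ge_atTop T₀] with T hT
    have e : u (T + 2) = u T * ((1 - y T) * (1 - y (T + 1))) := by rw [hsucc, hsucc]; ring
    have : (1 - y T) * (1 - y (T + 1)) ≤ 1 - δ := by
      rcases h T hT with h | h <;> nlinarith [h0 T, h1 T, h0 (T + 1), h1 (T + 1)]
    rw [e, mul_comm (1 - δ)]
    exact mul_le_mul_of_nonneg_left this (hu0 T)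
  have hle : ℓ ≤ (1 - δ) * ℓ :=
    le_of_tendsto_of_tendsto (hlim.comp (Filter.tendsto_add_atTop_nat 2)) (hlim.const_mul _) hstep
  have : ℓ = 0 := by nlinarith
  rwa [this] at hlim

/-- The factory for an open set `D` of biases: given a coin of bias `p` and, for the points `c` of `L`,
coins of bias `h_c(p)`, a continuous target with polynomial bounds is the probability of a
discernible event. -/
theorem exists_event {D : Set unitInterval} {L : List unitInterval} {m : ℕ}
    {G : Fin m → Matrix.unitaryGroup (Fin 2) ℂ} {i : Fin m} (hD : IsOpen D)
    (hD01 : ∀ p ∈ D, (0 : ℝ) < p ∧ (p : ℝ) < 1)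
    (hDL : ∀ p : unitInterval, (0 : ℝ) < p → (p : ℝ) < 1 → p ∉ D → p ∈ L)
    (hi : ∀ p, outcomeProb (G i) p 0 = p) (hG : ∀ c ∈ L, Realizable G (fun p => hFun c p))
    {f : unitInterval → ℝ} (hf : ContinuousOn f D) {k : ℕ}
    (hbound : ∀ p ∈ D, aProd L p ^ k ≤ f p ∧ f p ≤ 1 - aProd L p ^ k) :
    ∃ S : Set (Flips m), MeasurableSet S ∧ ∀ p ∈ D, Discernible (flipLaw G p) S ∧
      (flipLaw G p).real S = f p := by
  classical
  -- The targets, with the bounds that every step preserves.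
  let State := {φ : unitInterval → ℝ // ContinuousOn φ D ∧
    ∃ κ > 0, ∀ p ∈ D, κ * aProd L p ^ k ≤ φ p ∧ κ * aProd L p ^ k ≤ 1 - φ p}
  have hnn : ∀ {κ : ℝ} (p : unitInterval), 0 < κ → 0 ≤ κ * aProd L p ^ k := fun p h =>
    mul_nonneg h.le (pow_nonneg (aProd_nonneg L p) k)
  have h01 : ∀ φ : State, ∀ p ∈ D, φ.1 p ∈ Set.Icc (0 : ℝ) 1 := by
    rintro ⟨φ, -, κ, hκ, h⟩ p hp
    have := hnn p hκ
    exact ⟨by linarith [(h p hp).1], by linarith [(h p hp).2]⟩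
  let Q := L.filter fun c => decide (c ∉ D)
  have hQD : ∀ {p}, 0 < aProd Q p → p ∈ D := by
    intro p hp
    by_contra hpD
    have := aProd_eq_zero_of_mem (List.mem_filter.2 ⟨hDL p (by linarith [aProd_le Q p])
      (by linarith [aProd_le_one_sub Q p]) hpD, by simpa using hpD⟩ : p ∈ Q)
    linarith
  have hDQ : ∀ p ∈ D, 0 < aProd Q p := fun p hp =>
    aProd_pos (hD01 p hp).1 (hD01 p hp).2 fun c hc he => by
      have := (List.mem_filter.1 hc).2
      simp [he, hp] at this
  -- The compact sets `{1 / (t + 1) ≤ aProd Q}` exhaust `D`.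
  have hstep : ∀ (φ : State) (t : ℕ), ∃ y, Realizable G y ∧ Continuous y ∧
      (∀ p ∈ D, y p ≤ φ.1 p / 2) ∧
      ∀ p, 1 / ((t : ℝ) + 1) ≤ aProd Q p → 1 / 2 ≤ φ.1 p → 1 / 32 ≤ y p := by
    rintro φ t
    obtain ⟨hφ, κ, hκ, h⟩ := φ.2
    exact exists_step hD hD01 hDL hi hG hφ hκ (fun p hp => (h p hp).1) (fun p hp => (h01 φ p hp).2)
      (K := {p | 1 / ((t : ℝ) + 1) ≤ aProd Q p})
      (isClosed_le continuous_const (continuous_aProd Q))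
      (fun p hp => hQD (lt_of_lt_of_le (by positivity) hp.out))
  choose Y hYr hYc hYle hYge using hstep
  have hpos : ∀ (φ : State) t, ∀ p ∈ D, 1 / 2 ≤ 1 - Y φ t p := fun φ t p hp => by
    linarith [hYle φ t p hp, (h01 φ p hp).2]
  let next : State → ℕ → State := fun φ t => ⟨fun p => (1 - φ.1 p) / (1 - Y φ t p), by
    obtain ⟨hφ, κ, hκ, h⟩ := φ.2
    refine ⟨(continuousOn_const.sub hφ).div (continuousOn_const.sub (hYc φ t).continuousOn)
      fun p hp => by linarith [hpos φ t p hp], κ / 2, by positivity, fun p hp => ?_⟩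
    have hq := hpos φ t p hp
    have hy := hYle φ t p hp
    have hy0 := (hYr φ t).nonneg p
    have h1 := h p hp
    have h2 := hnn p hκ
    rw [one_sub_div (by linarith), le_div_iff₀ (by linarith), le_div_iff₀ (by linarith)]
    constructor <;> nlinarith⟩
  let s : ℕ → State := fun t => Nat.rec ⟨f, hf, 1, one_pos, fun p hp => by
    have := hbound p hp
    constructor <;> linarith⟩ (fun t φ => next φ t) t
  have hs : ∀ t, s (t + 1) = next (s t) t := fun _ => rfl
  refine exists_event_of_steps (y := fun t => Y (s t) t) (φ := fun t => (s t).1)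
    (fun t => hYr _ _) (fun t p hp => h01 _ p hp) (fun t p hp => ?_) (fun p hp => ?_)
  · have := hpos (s t) t p hp
    rw [hs]
    exact div_mul_cancel₀ _ (by linarith)
  · obtain ⟨T₀, hT₀⟩ := exists_nat_one_div_lt (hDQ p hp)
    have hT : ∀ t ≥ T₀, 1 / ((t : ℝ) + 1) ≤ aProd Q p := fun t ht =>
      (one_div_le_one_div_of_le (by positivity) (by gcongr)).trans hT₀.le
    refine tendsto_prod_one_sub (δ := 1 / 32) (T₀ := T₀) (by norm_num)
      (fun t => (hYr _ _).nonneg p) (fun t => (hYr _ _).le_one p) fun t ht => ?_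
    -- The next target is at least `1 - φ`, so one of two consecutive targets is at least `1/2`.
    by_cases h : 1 / 2 ≤ (s t).1 p
    · exact Or.inl (hYge _ _ p (hT t ht) h)
    · refine Or.inr (hYge _ _ p (hT (t + 1) (by omega)) ?_)
      have h1 := hpos (s t) t p hp
      have h2 := (hYr (s t) t).nonneg p
      rw [hs]
      change 1 / 2 ≤ (1 - (s t).1 p) / (1 - Y (s t) t p)
      rw [le_div_iff₀ (by linarith)]
      linarith [not_le.1 h]

end QuoinFactory

end

theorem theorem2 (A : Finset ℝ) (hA : ∀ x ∈ A, x ∈ Set.Ioo (0 : ℝ) 1)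
    (f : ℝ → ℝ) (hfcont : ContinuousOn f (Set.Ioo (0 : ℝ) 1 \ (A : Set ℝ)))
    (hf01 : ∀ p ∈ Set.Ioo (0 : ℝ) 1 \ (A : Set ℝ), f p ∈ Set.Icc (0 : ℝ) 1)
    (L : List ℝ) (hL : ∀ x ∈ L, x ∈ Set.Icc (0 : ℝ) 1) (hAL : ∀ x ∈ A, x ∈ L)
    (k : ℕ)
    (hbound : ∀ p ∈ Set.Ioo (0 : ℝ) 1 \ (A : Set ℝ),
      QuoinFactory.aFun L p ^ k ≤ f p ∧ f p ≤ 1 - QuoinFactory.aFun L p ^ k) :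
    QuoinFactory.ConstructibleOn (Set.Ioo (0 : ℝ) 1 \ (A : Set ℝ)) f := by
  open QuoinFactory in
  lift L to List unitInterval using hL
  let b : Fin (L.length + 1) → unitInterval := Fin.cons 0 fun j => unitInterval.symm L[j]
  have hDopen : IsOpen (Set.Ioo (0 : ℝ) 1 \ (A : Set ℝ)) := isOpen_Ioo.sdiff A.finite_toSet.isClosed
  obtain ⟨S, hS, h⟩ := exists_event (D := Subtype.val ⁻¹' (Set.Ioo (0 : ℝ) 1 \ (A : Set ℝ))) (L := L)
    (G := fun i => hadamard (b i)) (i := 0) (f := fun p => f p) (k := k)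
    (hDopen.preimage continuous_subtype_val) (fun p hp => hp.1)
    (fun p h0 h1 hp => by
      have hpA : (p : ℝ) ∈ A := by
        by_contra hpA
        exact hp ⟨⟨h0, h1⟩, hpA⟩
      obtain ⟨q, hq, he⟩ := List.mem_map.1 (hAL _ hpA)
      rwa [← Subtype.ext he])
    (fun p => outcomeProb_hadamard_zero p)
    (fun c hc => by
      obtain ⟨j, hj, rfl⟩ := List.getElem_of_mem hc
      have := realizable_outcomeProb (G := fun i => hadamard (b i)) (Fin.succ ⟨j, hj⟩) 1
      have hb : b (Fin.succ ⟨j, hj⟩) = unitInterval.symm L[j] := Fin.cons_succ _ _ _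
      simpa only [hb, outcomeProb_hadamard_symm] using this)
    (hfcont.comp continuous_subtype_val.continuousOn fun p hp => hp)
    (fun p hp => by simpa only [aFun_map_coe] using hbound p hp)
  refine ⟨L.length + 1, b, S, hS, fun p hp => ⟨(h p hp).1, ?_⟩⟩
  rw [← (h p hp).2, ofReal_measureReal]
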